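/- Let $\Lambda\subseteq[0,\infty)$ be an additive semigroup with $0\in\Lambda$, and let $w\colon\Lambda\to(0,\infty)$ be an admissible weight function, that is, $w(0)=1$, $w(\lambda+\lambda')\le w(\lambda)\,w(\lambda')$ and $w(\lambda)\ge 1$ for all $\lambda,\lambda'\in\Lambda$, and $\lim_{k\to\infty}w(k\lambda)^{1/k}=1$ for every $\lambda\in\Lambda$. Let $\mathscr{A}_w=\mathscr{A}_w(\Lambda)$ be the commutative unital Banach algebra of all functions $a\colon\Lambda\to\mathbb{C}$ with $\|a\|_w:=\sum_{\lambda\in\Lambda}|a(\lambda)|\,w(\lambda)<\infty$, with pointwise linear operations, the convolution product $$(a*b)(\lambda)=\sum_{\substack{\lambda',\lambda''\in\Lambda\\ \lambda'+\lambda''=\lambda}}a(\lambda')\,b(\lambda'')$$ and the unit $\varepsilon$ given by $\varepsilon(0)=1$ and $\varepsilon(\lambda)=0$ for $\lambda\ne0$. For $a\in\mathscr{A}_w$ and $\operatorname{Re}s\ge0$ let $\widetilde a(s)=\sum_{\lambda\in\Lambda}a(\lambda)\,e^{-\lambda s}$ be the associated (absolutely convergent) general Dirichlet series, and let $\mathbb{H}=\{s\in\mathbb{C}:\operatorname{Re}s>0\}$.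 Then the group $\mathscr{A}_w^*$ of invertible elements of $\mathscr{A}_w$ is $$\mathscr{A}_w^*=\{a\in\mathscr{A}_w: 0\notin\overline{\widetilde a(\mathbb{H})}\}.$$ -/

import Mathlib

open Filter Topology

noncomputable section

/-- A weight function on a commutative monoid `M`, written additively: a function
`w : M → (0, ∞)` with `w 0 = 1` which is submultiplicative. -/
structure Weight (M : Type*) [AddCommMonoid M] where
  /-- the underlying function -/
  toFun : M → ℝ
  pos' : ∀ x, 0 < toFun x
  map_zero' : toFun 0 = 1
  map_add_le' : ∀ x y, toFun (x + y) ≤ toFun x * toFun y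

namespace Weight

variable {M : Type*} [AddCommMonoid M]

instance : CoeFun (Weight M) (fun _ => M → ℝ) := ⟨Weight.toFun⟩

lemma pos (w : Weight M) (x : M) : 0 < w x := w.pos' x
lemma map_zero (w : Weight M) : w 0 = 1 := w.map_zero'
lemma map_add_le (w : Weight M) (x y : M) : w (x + y) ≤ w x * w y := w.map_add_le' x y

/-- A weight is admissible if `w ≥ 1` and `w (k x) ^ (1 / k) → 1` as `k → ∞`, for all `x`. -/
structure Admissible (w : Weight M) : Prop where
  one_le : ∀ x, 1 ≤ w x
  tendsto_root : ∀ x, Tendsto (fun k : ℕ => (w (k • x)) ^ (1 / (k : ℝ))) atTop (𝓝 1)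

/-- The families `a : M → ℂ` with `∑ |a x| w x < ∞`, as a linear subspace of all families. -/
def summableSubmodule (w : Weight M) : Submodule ℂ (M → ℂ) where
  carrier := {a | Summable fun x => ‖a x‖ * w x}
  zero_mem' := by simp
  add_mem' := by
    intro a b ha hb
    refine Summable.of_nonneg_of_le (fun x => mul_nonneg (norm_nonneg _) (w.pos x).le)
      (fun x => ?_) (Summable.add ha hb)
    rw [← add_mul]
    exact mul_le_mul_of_nonneg_right (norm_add_le _ _) (w.pos x).le
  smul_mem' := by
    intro c a ha
    refine (Summable.mul_left ‖c‖ ha).congr (fun x => ?_)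
    simp [mul_assoc]

end Weight

/-- The weighted convolution algebra `𝒜_w(M)`: all families `a : M → ℂ` with
`‖a‖_w = ∑ |a x| w x < ∞`. -/
def WeightedAlgebra {M : Type*} [AddCommMonoid M] (w : Weight M) : Type _ :=
  w.summableSubmodule

namespace WeightedAlgebra

variable {M : Type*} [AddCommMonoid M] {w : Weight M}

instance : AddCommGroup (WeightedAlgebra w) := inferInstanceAs (AddCommGroup w.summableSubmodule)
instance : Module ℂ (WeightedAlgebra w) := inferInstanceAs (Module ℂ w.summableSubmodule)
instance : FunLike (WeightedAlgebra w) M ℂ := ⟨fun a => a.1, fun _ _ h => Subtype.ext h⟩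

lemma summable (a : WeightedAlgebra w) : Summable fun x => ‖a x‖ * w x := a.2

/-- Build an element of the algebra from a family. -/
def mk (a : M → ℂ) (ha : Summable fun x => ‖a x‖ * w x) : WeightedAlgebra w := ⟨a, ha⟩

@[simp] lemma mk_apply (a : M → ℂ) (ha : Summable fun x => ‖a x‖ * w x) (x : M) :
    mk a ha x = a x := rfl

@[ext] lemma ext {a b : WeightedAlgebra w} (h : ∀ x, a x = b x) : a = b :=
  DFunLike.ext _ _ h

@[simp] lemma add_apply (a b : WeightedAlgebra w) (x : M) : (a + b) x = a x + b x := rfl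
@[simp] lemma neg_apply (a : WeightedAlgebra w) (x : M) : (-a) x = -a x := rfl
@[simp] lemma zero_apply (x : M) : (0 : WeightedAlgebra w) x = 0 := rfl
@[simp] lemma smul_apply (c : ℂ) (a : WeightedAlgebra w) (x : M) : (c • a) x = c * a x := rfl

/-- The convolution `(a * b)(x) = ∑ a(y) b(z)` over all pairs with `y + z = x`. -/
def conv (a b : M → ℂ) (x : M) : ℂ :=
  ∑' p : {p : M × M // p.1 + p.2 = x}, a p.1.1 * b p.1.2

lemma summable_prod (a b : WeightedAlgebra w) :
    Summable fun p : M × M => ‖a p.1 * b p.2‖ * (w p.1 * w p.2) := by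
  refine (a.summable.mul_of_nonneg b.summable
    (fun x => mul_nonneg (norm_nonneg _) (w.pos x).le)
    (fun x => mul_nonneg (norm_nonneg _) (w.pos x).le)).congr (fun _ => ?_)
  rw [norm_mul]; ring

lemma summable_prod' (a b : WeightedAlgebra w) :
    Summable fun p : M × M => ‖a p.1 * b p.2‖ * w (p.1 + p.2) :=
  (summable_prod a b).of_nonneg_of_le (fun _ => mul_nonneg (norm_nonneg _) (w.pos _).le)
    (fun _ => mul_le_mul_of_nonneg_left (w.map_add_le _ _) (norm_nonneg _))

/-- Pairs, sorted by their sum. -/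
def fiberEquiv (M : Type*) [AddCommMonoid M] :
    (Σ x : M, {p : M × M // p.1 + p.2 = x}) ≃ M × M :=
  Equiv.sigmaFiberEquiv (fun p : M × M => p.1 + p.2)

lemma summable_sigma (a b : WeightedAlgebra w) :
    Summable fun q : (Σ x : M, {p : M × M // p.1 + p.2 = x}) =>
      ‖a q.2.1.1 * b q.2.1.2‖ * w q.1 := by
  refine ((fiberEquiv M).summable_iff.mpr (summable_prod' a b)).congr ?_
  rintro ⟨x, p, rfl⟩
  rfl

/-- The sums that define the convolution converge absolutely. -/
lemma summable_fiber (a b : WeightedAlgebra w) (x : M) :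
    Summable fun p : {p : M × M // p.1 + p.2 = x} => ‖a p.1.1 * b p.1.2‖ := by
  have h := (summable_sigma a b).sigma_factor x
  exact (summable_mul_right_iff (w.pos x).ne').mp h

lemma norm_conv_mul_le (a b : WeightedAlgebra w) (x : M) :
    ‖conv a b x‖ * w x ≤
      ∑' p : {p : M × M // p.1 + p.2 = x}, ‖a p.1.1 * b p.1.2‖ * w x := by
  rw [tsum_mul_right]
  exact mul_le_mul_of_nonneg_right (norm_tsum_le_tsum_norm (summable_fiber a b x)) (w.pos x).le

lemma summable_conv (a b : WeightedAlgebra w) : Summable fun x => ‖conv a b x‖ * w x :=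
  (summable_sigma a b).sigma.of_nonneg_of_le
    (fun x => mul_nonneg (norm_nonneg _) (w.pos x).le) (norm_conv_mul_le a b)

instance : Mul (WeightedAlgebra w) := ⟨fun a b => mk (conv a b) (summable_conv a b)⟩

lemma mul_apply (a b : WeightedAlgebra w) (x : M) :
    (a * b) x = ∑' p : {p : M × M // p.1 + p.2 = x}, a p.1.1 * b p.1.2 := rfl

open Classical in
/-- The unit `ε`, with `ε(0) = 1` and `ε(x) = 0` for `x ≠ 0`. -/
instance : One (WeightedAlgebra w) :=
  ⟨mk (fun x => if x = 0 then 1 else 0)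
    (summable_of_ne_finset_zero (s := {0}) (fun x hx => by simp_all))⟩

open Classical in
lemma one_apply (x : M) : (1 : WeightedAlgebra w) x = if x = 0 then 1 else 0 := rfl

/-- Summation of a convolution against a `w`-bounded function. -/
lemma tsum_mul_apply (a b : WeightedAlgebra w) (φ : M → ℂ) (C : ℝ) (hφ : ∀ x, ‖φ x‖ ≤ C * w x) :
    ∑' x, (a * b) x * φ x = ∑' p : M × M, a p.1 * b p.2 * φ (p.1 + p.2) := by
  have hs : Summable fun q : (Σ x : M, {p : M × M // p.1 + p.2 = x}) =>
      a q.2.1.1 * b q.2.1.2 * φ q.1 := by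
    refine Summable.of_norm_bounded ((summable_sigma a b).mul_left C) (fun q => ?_)
    rw [norm_mul]
    calc ‖a q.2.1.1 * b q.2.1.2‖ * ‖φ q.1‖
        ≤ ‖a q.2.1.1 * b q.2.1.2‖ * (C * w q.1) :=
          mul_le_mul_of_nonneg_left (hφ _) (norm_nonneg _)
      _ = C * (‖a q.2.1.1 * b q.2.1.2‖ * w q.1) := by ring
  rw [← (fiberEquiv M).tsum_eq]
  have h2 : ∀ q : (Σ x : M, {p : M × M // p.1 + p.2 = x}),
      a (fiberEquiv M q).1 * b (fiberEquiv M q).2 * φ ((fiberEquiv M q).1 + (fiberEquiv M q).2)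
        = a q.2.1.1 * b q.2.1.2 * φ q.1 := by
    rintro ⟨x, p, rfl⟩; rfl
  rw [tsum_congr h2, hs.tsum_sigma]
  refine tsum_congr (fun x => ?_)
  rw [mul_apply, ← tsum_mul_right]

open Classical in
/-- The indicator of a point, shifted by `z`, is `w`-bounded. -/
lemma norm_ite_le (z x : M) (y : M) :
    ‖(if y + z = x then (1 : ℂ) else 0)‖ ≤ (w z / w x) * w y := by
  split_ifs with h
  · subst h
    rw [norm_one, div_mul_eq_mul_div, le_div_iff₀ (w.pos _), one_mul, mul_comm (w z)]
    exact w.map_add_le _ _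
  · rw [norm_zero]
    exact mul_nonneg (div_nonneg (w.pos _).le (w.pos _).le) (w.pos _).le

open Classical in
lemma mul_apply_prod (a b : WeightedAlgebra w) (x : M) :
    (a * b) x = ∑' p : M × M, a p.1 * b p.2 * (if p.1 + p.2 = x then 1 else 0) := by
  have h := tsum_mul_apply a b (fun y => if y = x then 1 else 0) (w 0 / w x)
    (fun y => by simpa using norm_ite_le (w := w) 0 x y)
  rw [← h, tsum_eq_single x (fun y hy => by simp [hy])]
  simp

open Classical in
protected lemma mul_comm (a b : WeightedAlgebra w) : a * b = b * a := by
  ext x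
  rw [mul_apply_prod, mul_apply_prod, ← (Equiv.prodComm M M).tsum_eq]
  refine tsum_congr (fun p => ?_)
  change a p.2 * b p.1 * (if p.2 + p.1 = x then 1 else 0) = _
  rw [mul_comm (a p.2)]
  have h : p.2 + p.1 = p.1 + p.2 := add_comm _ _
  by_cases hx : p.1 + p.2 = x
  · rw [if_pos hx, if_pos (h.trans hx)]
  · rw [if_neg hx, if_neg (fun h' => hx (h.symm.trans h'))]

open Classical in
lemma summable_ite (a b : WeightedAlgebra w) (x : M) :
    Summable fun p : M × M => a p.1 * b p.2 * (if p.1 + p.2 = x then 1 else 0) := by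
  refine Summable.of_norm_bounded ((summable_prod' a b).mul_right (1 / w x)) (fun p => ?_)
  rw [norm_mul, mul_assoc]
  refine mul_le_mul_of_nonneg_left ?_ (norm_nonneg _)
  have := norm_ite_le (w := w) 0 x (p.1 + p.2)
  rw [add_zero, w.map_zero] at this
  linarith

open Classical in
lemma mul_mul_apply (a b c : WeightedAlgebra w) (x : M) :
    ((a * b) * c) x = ∑' z, ∑' p : M × M,
      a p.1 * b p.2 * c z * (if p.1 + p.2 + z = x then 1 else 0) := by
  rw [mul_apply_prod, ← (Equiv.prodComm M M).tsum_eq]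
  have hs : Summable fun p : M × M => (a * b) p.2 * c p.1 * (if p.2 + p.1 = x then 1 else 0) :=
    (Equiv.prodComm M M).summable_iff.mpr (summable_ite (a * b) c x)
  refine (hs.tsum_prod).trans (tsum_congr (fun z => ?_))
  have h := tsum_mul_apply a b (fun y => if y + z = x then 1 else 0) (w z / w x)
    (norm_ite_le z x)
  calc ∑' y, (a * b) y * c z * (if y + z = x then 1 else 0)
      = c z * ∑' y, (a * b) y * (if y + z = x then 1 else 0) := by
        rw [← tsum_mul_left]; exact tsum_congr (fun y => by ring)
    _ = _ := by
        rw [h, ← tsum_mul_left]; exact tsum_congr (fun y => by ring)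

open Classical in
/-- The triple product as a sum over triples. -/
lemma mul_mul_apply' (a b c : WeightedAlgebra w) (x : M) :
    ((a * b) * c) x = ∑' q : M × (M × M),
      a q.2.1 * b q.2.2 * c q.1 * (if q.2.1 + q.2.2 + q.1 = x then 1 else 0) := by
  rw [mul_mul_apply]
  have h3 : Summable fun q : M × (M × M) =>
      (‖c q.1‖ * w q.1) * (‖a q.2.1 * b q.2.2‖ * (w q.2.1 * w q.2.2)) :=
    c.summable.mul_of_nonneg (summable_prod a b)
      (fun x => mul_nonneg (norm_nonneg _) (w.pos x).le)
      (fun p => mul_nonneg (norm_nonneg _) (mul_nonneg (w.pos _).le (w.pos _).le))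
  have hs : Summable fun q : M × (M × M) =>
      a q.2.1 * b q.2.2 * c q.1 * (if q.2.1 + q.2.2 + q.1 = x then (1 : ℂ) else 0) := by
    refine Summable.of_norm_bounded (h3.mul_right (1 / w x)) (fun q => ?_)
    have h1 := norm_ite_le (w := w) q.1 x (q.2.1 + q.2.2)
    have h2 : w q.1 / w x * w (q.2.1 + q.2.2) ≤ w q.1 / w x * (w q.2.1 * w q.2.2) :=
      mul_le_mul_of_nonneg_left (w.map_add_le _ _) (div_nonneg (w.pos _).le (w.pos _).le)
    rw [norm_mul, norm_mul _ (c q.1)]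
    calc _ ≤ ‖a q.2.1 * b q.2.2‖ * ‖c q.1‖ * (w q.1 / w x * (w q.2.1 * w q.2.2)) :=
          mul_le_mul_of_nonneg_left (h1.trans h2) (by positivity)
      _ = _ := by ring
  exact hs.tsum_prod.symm

open Classical in
protected lemma mul_assoc (a b c : WeightedAlgebra w) : a * b * c = a * (b * c) := by
  rw [WeightedAlgebra.mul_comm a (b * c)]
  ext x
  rw [mul_mul_apply', mul_mul_apply']
  let e : M × (M × M) ≃ M × (M × M) :=
    { toFun := fun q => (q.2.2, (q.1, q.2.1))
      invFun := fun q => (q.2.1, (q.2.2, q.1))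
      left_inv := fun _ => rfl
      right_inv := fun _ => rfl }
  rw [← e.tsum_eq]
  refine tsum_congr (fun q => ?_)
  change a q.1 * b q.2.1 * c q.2.2 * (if q.1 + q.2.1 + q.2.2 = x then 1 else 0) =
    b q.2.1 * c q.2.2 * a q.1 * (if q.2.1 + q.2.2 + q.1 = x then 1 else 0)
  rw [show q.2.1 + q.2.2 + q.1 = q.1 + q.2.1 + q.2.2 by rw [add_comm, add_assoc]]
  ring

protected lemma one_mul (a : WeightedAlgebra w) : 1 * a = a := by
  ext x
  rw [mul_apply, tsum_eq_single ⟨(0, x), zero_add x⟩]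
  · simp [one_apply]
  · rintro ⟨⟨y, z⟩, h⟩ hne
    have hy : y ≠ 0 := by
      rintro rfl
      apply hne
      simp only [zero_add] at h
      subst h
      rfl
    simp [one_apply, hy]

protected lemma add_mul (a b c : WeightedAlgebra w) : (a + b) * c = a * c + b * c := by
  ext x
  rw [add_apply, mul_apply, mul_apply, mul_apply,
    ← (summable_fiber a c x).of_norm.tsum_add (summable_fiber b c x).of_norm]
  exact tsum_congr (fun p => by rw [add_apply, add_mul])

protected lemma zero_mul (a : WeightedAlgebra w) : 0 * a = 0 := by
  ext x
  simp [mul_apply]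

/-- `𝒜_w(M)` is a commutative ring under convolution. -/
instance : CommRing (WeightedAlgebra w) :=
  { (inferInstance : AddCommGroup (WeightedAlgebra w)) with
    mul := (· * ·)
    one := 1
    mul_assoc := WeightedAlgebra.mul_assoc
    mul_comm := WeightedAlgebra.mul_comm
    one_mul := WeightedAlgebra.one_mul
    mul_one := fun a => by rw [WeightedAlgebra.mul_comm, WeightedAlgebra.one_mul]
    right_distrib := WeightedAlgebra.add_mul
    left_distrib := fun a b c => by
      rw [WeightedAlgebra.mul_comm, WeightedAlgebra.add_mul, WeightedAlgebra.mul_comm b,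
        WeightedAlgebra.mul_comm c]
    zero_mul := WeightedAlgebra.zero_mul
    mul_zero := fun a => by rw [WeightedAlgebra.mul_comm, WeightedAlgebra.zero_mul] }

protected lemma smul_mul (c : ℂ) (a b : WeightedAlgebra w) : c • a * b = c • (a * b) := by
  ext x
  rw [smul_apply, mul_apply, mul_apply, ← tsum_mul_left]
  exact tsum_congr (fun p => by rw [smul_apply, mul_assoc])

instance : Algebra ℂ (WeightedAlgebra w) :=
  Algebra.ofModule WeightedAlgebra.smul_mul (fun c a b => by
    rw [mul_comm, WeightedAlgebra.smul_mul, mul_comm])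

/-- The weighted norm `‖a‖_w = ∑ |a x| w x`. -/
instance : Norm (WeightedAlgebra w) := ⟨fun a => ∑' x, ‖a x‖ * w x⟩

lemma norm_def (a : WeightedAlgebra w) : ‖a‖ = ∑' x, ‖a x‖ * w x := rfl

lemma norm_core : NormedSpace.Core ℂ (WeightedAlgebra w) where
  norm_nonneg a := tsum_nonneg (fun x => mul_nonneg (norm_nonneg _) (w.pos x).le)
  norm_smul c a := by
    rw [norm_def, norm_def, ← tsum_mul_left]
    exact tsum_congr (fun x => by rw [smul_apply, norm_mul, mul_assoc])
  norm_triangle a b := by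
    rw [norm_def, norm_def, norm_def, ← a.summable.tsum_add b.summable]
    refine (a + b).summable.tsum_le_tsum (fun x => ?_) (a.summable.add b.summable)
    rw [← add_mul]
    exact mul_le_mul_of_nonneg_right (norm_add_le _ _) (w.pos x).le
  norm_eq_zero_iff a := by
    constructor
    · intro h
      have h0 := (hasSum_zero_iff_of_nonneg
        (fun x => mul_nonneg (norm_nonneg _) (w.pos x).le)).mp (show HasSum (fun x => ‖a x‖ * w x) 0 from
          (show ∑' x, ‖a x‖ * w x = 0 from h) ▸ a.summable.hasSum)
      ext x
      have hx : ‖a x‖ * w x = 0 := congrFun h0 x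
      simpa [(w.pos x).ne'] using hx
    · rintro rfl
      simp [norm_def]

lemma norm_mul_le' (a b : WeightedAlgebra w) : ‖a * b‖ ≤ ‖a‖ * ‖b‖ := by
  have h1 : ‖a * b‖ ≤ ∑' p : M × M, ‖a p.1 * b p.2‖ * w (p.1 + p.2) := by
    rw [norm_def, ← (fiberEquiv M).tsum_eq]
    have h2 : ∀ q : (Σ x : M, {p : M × M // p.1 + p.2 = x}),
        ‖a (fiberEquiv M q).1 * b (fiberEquiv M q).2‖ *
          w ((fiberEquiv M q).1 + (fiberEquiv M q).2) = ‖a q.2.1.1 * b q.2.1.2‖ * w q.1 := by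
      rintro ⟨x, p, rfl⟩; rfl
    rw [tsum_congr h2, (summable_sigma a b).tsum_sigma]
    exact (summable_conv a b).tsum_le_tsum (norm_conv_mul_le a b) (summable_sigma a b).sigma
  refine h1.trans (((summable_prod' a b).tsum_le_tsum (fun p =>
    mul_le_mul_of_nonneg_left (w.map_add_le _ _) (norm_nonneg _)) (summable_prod a b)).trans ?_)
  have h3 : Summable fun p : M × M => (‖a p.1‖ * w p.1) * (‖b p.2‖ * w p.2) :=
    (summable_prod a b).congr (fun p => by rw [norm_mul]; ring)
  rw [norm_def, norm_def, a.summable.tsum_mul_tsum b.summable h3]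
  exact (tsum_congr (fun p => by rw [norm_mul]; ring)).le

instance : NormedAddCommGroup (WeightedAlgebra w) := NormedAddCommGroup.ofCore norm_core

instance : NormedCommRing (WeightedAlgebra w) :=
  { (inferInstance : NormedAddCommGroup (WeightedAlgebra w)),
    (inferInstance : CommRing (WeightedAlgebra w)) with
    norm_mul_le := norm_mul_le' }

instance : NormedAlgebra ℂ (WeightedAlgebra w) :=
  { (inferInstance : Algebra ℂ (WeightedAlgebra w)) with
    norm_smul_le := fun c a => (norm_core.norm_smul c a).le }

instance : NormOneClass (WeightedAlgebra w) := ⟨by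
  rw [norm_def, tsum_eq_single 0 (fun x hx => by simp [one_apply, hx])]
  simp [one_apply, w.map_zero]⟩

/-- Multiplication by `w` identifies `𝒜_w(M)` isometrically with the unweighted `ℓ¹(M)`. -/
def toLp (w : Weight M) : WeightedAlgebra w ≃ₗᵢ[ℂ] lp (fun _ : M => ℂ) 1 where
  toFun a := ⟨fun x => (w x : ℂ) * a x, by
    refine memℓp_gen (a.summable.congr (fun x => ?_))
    simp [abs_of_pos (w.pos x), mul_comm]⟩
  invFun f := mk (fun x => (w x : ℂ)⁻¹ * f x) (by
    have h := (lp.memℓp f).summable (by simp)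
    refine h.congr (fun x => ?_)
    have := (w.pos x).ne'
    simp only [norm_mul, norm_inv, Complex.norm_real, Real.norm_eq_abs, abs_of_pos (w.pos x),
      ENNReal.toReal_one, Real.rpow_one]
    field_simp)
  left_inv a := by
    ext x
    have : (w x : ℂ) ≠ 0 := by exact_mod_cast (w.pos x).ne'
    simp [this]
  right_inv f := by
    ext x
    have : (w x : ℂ) ≠ 0 := by exact_mod_cast (w.pos x).ne'
    simp [this]
  map_add' a b := by ext x; exact mul_add _ _ _
  map_smul' c a := by ext x; simp [mul_left_comm]
  norm_map' a := by
    rw [lp.norm_eq_tsum_rpow (by simp), norm_def]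
    simp [abs_of_pos (w.pos _), mul_comm]

/-- `𝒜_w(M)` is complete, hence a commutative unital Banach algebra. -/
instance : CompleteSpace (WeightedAlgebra w) :=
  (toLp w).toIsometryEquiv.completeSpace

end WeightedAlgebra

/-- The general Dirichlet series `ã(s) = ∑ a(l) exp (-l s)`, summed over all `l ∈ Λ`. -/
def dirichletSeries {Λ : AddSubmonoid ℝ} (a : Λ → ℂ) (s : ℂ) : ℂ :=
  ∑' l : Λ, a l * Complex.exp (-((l : ℝ) : ℂ) * s)

/-- The series converges absolutely for `Re s ≥ 0` if `a ∈ 𝒜_w(Λ)`, `Λ ⊆ [0, ∞)` and `w ≥ 1`. -/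
lemma summable_dirichletSeries {Λ : AddSubmonoid ℝ} (hΛ : (Λ : Set ℝ) ⊆ Set.Ici 0)
    {w : Weight Λ} (hw : w.Admissible) (a : WeightedAlgebra w) {s : ℂ} (hs : 0 ≤ s.re) :
    Summable fun l : Λ => ‖a l * Complex.exp (-((l : ℝ) : ℂ) * s)‖ := by
  refine a.summable.of_nonneg_of_le (fun _ => norm_nonneg _) (fun l => ?_)
  rw [norm_mul]
  refine mul_le_mul_of_nonneg_left (le_trans ?_ (hw.one_le l)) (norm_nonneg _)
  rw [Complex.norm_exp, Real.exp_le_one_iff]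
  have : (0 : ℝ) ≤ (l : ℝ) := hΛ l.2
  simpa using mul_nonneg this hs

end

/-!
A semicharacter of `Λ` is a function `φ : Λ → ℂ` with `φ 0 = 1`, `φ (x + y) = φ x * φ y`; if it is
bounded by the weight, `a ↦ ∑ a l * φ l` is a multiplicative functional, and every character of the
algebra arises in this way. The semicharacters `l ↦ exp (-l s)` with `Re s > 0` show that a unit has
a Dirichlet series bounded away from zero (`zero_notMem_closure_of_isUnit`).

For the converse let the Dirichlet series of `a` be at least `δ > 0` in modulus on the half-plane.
Admissibility forces every semicharacter bounded by `w` to be bounded by `1`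
(`norm_character_single_le_one`), so it acts on `ℓ¹(Λ)`. By Gelfand theory it suffices that `a` is
invertible in `ℓ¹(Λ)`. Semicharacters may vanish at some points of `Λ` and then need not be limits
of exponentials, so this is not a matter of density. Instead `ℓ¹(Λ)` is embedded isometrically in
`ℓ¹(ℝ)`, where `ℝ` is a discrete group. Characters of `ℓ¹(ℝ)` come from homomorphisms of `ℝ` to the
unit circle, which are pointwise limits of `l ↦ exp (-i l t)` by Kronecker's theorem
(`mem_closure_range_exp`). Consider the path `a_r l = a l * r ^ l`, `0 ≤ r ≤ 1`, which corresponds to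
translating the Dirichlet series to the right. All characters of `ℓ¹(ℝ)` are at least `δ` in modulus
on every `a_r`, so the `a_r` are invertible in `ℓ¹(ℝ)` (`isUnit_extendZero_dampen`). At `r = 0` the
path is at the scalar `a 0 ≠ 0`, which is invertible in `ℓ¹(Λ)`. Invertibility in the closed
subalgebra `ℓ¹(Λ)` is an open and closed condition along a path of units of `ℓ¹(ℝ)`
(`isUnit_of_path`), so it holds at `r = 1`, where `a_1 = a`.

Kronecker's theorem is proved with mean values: if the phases of `n` exponentials agree with those
of a character of `ℝ`, then the supremum of the modulus of their sum is `n`, for the `k`-th power of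
the sum has only polynomially many terms in `k`, while its coefficients are nonnegative with sum
`n ^ k`.
-/

open Filter Topology

noncomputable section

/-! ### Point masses and multiplicative functionals -/

namespace WeightedAlgebra

variable {M : Type*} [AddCommMonoid M] {w : Weight M}

lemma norm_apply_mul_le (a : WeightedAlgebra w) (x : M) : ‖a x‖ * w x ≤ ‖a‖ :=
  a.summable.le_tsum x fun y _ => mul_nonneg (norm_nonneg _) (w.pos y).le

lemma summable_mul_char (a : WeightedAlgebra w) {φ : M → ℂ} (hφ : ∀ x, ‖φ x‖ ≤ w x) :
    Summable fun x => ‖a x * φ x‖ :=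
  a.summable.of_nonneg_of_le (fun _ => norm_nonneg _) fun x => by
    rw [norm_mul]
    exact mul_le_mul_of_nonneg_left (hφ x) (norm_nonneg _)

lemma norm_tsum_mul_char_le (a : WeightedAlgebra w) {φ : M → ℂ} (hφ : ∀ x, ‖φ x‖ ≤ w x) :
    ‖∑' x, a x * φ x‖ ≤ ‖a‖ :=
  (norm_tsum_le_tsum_norm (summable_mul_char a hφ)).trans <|
    (summable_mul_char a hφ).tsum_le_tsum (fun x => by
      rw [norm_mul]
      exact mul_le_mul_of_nonneg_left (hφ x) (norm_nonneg _)) a.summable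

/-- A `w`-bounded semicharacter `φ` of `M` defines a multiplicative functional. -/
lemma tsum_mul_char_mul (a b : WeightedAlgebra w) {φ : M → ℂ} (hφ : ∀ x, ‖φ x‖ ≤ w x)
    (hadd : ∀ x y, φ (x + y) = φ x * φ y) :
    ∑' x, (a * b) x * φ x = (∑' x, a x * φ x) * ∑' x, b x * φ x := by
  rw [tsum_mul_apply a b φ 1 (fun x => by rw [one_mul]; exact hφ x),
    tsum_mul_tsum_of_summable_norm (summable_mul_char a hφ) (summable_mul_char b hφ)]
  exact tsum_congr fun p => by rw [hadd]; ring

lemma tsum_one_mul_char {φ : M → ℂ} (h0 : φ 0 = 1) :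
    ∑' x, (1 : WeightedAlgebra w) x * φ x = 1 := by
  rw [tsum_eq_single 0 fun x hx => by simp [one_apply, hx]]
  simp [one_apply, h0]

open Classical in
/-- The point mass at `x`. -/
def single (w : Weight M) (x : M) : WeightedAlgebra w :=
  mk (fun y => if y = x then 1 else 0)
    (summable_of_ne_finset_zero (s := {x}) fun y hy => by simp_all)

open Classical in
lemma single_apply (x y : M) : single w x y = if y = x then 1 else 0 := rfl

lemma norm_single (x : M) : ‖single w x‖ = w x := by
  rw [norm_def, tsum_eq_single x fun y hy => by simp [single_apply, hy]]
  simp [single_apply]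

lemma single_zero : single w (0 : M) = 1 := rfl

lemma single_add (x y : M) : single w (x + y) = single w x * single w y := by
  ext z
  rw [mul_apply_prod, tsum_eq_single (x, y)]
  · by_cases h : x + y = z
    · simp [single_apply, h]
    · simp [single_apply, h, Ne.symm h]
  · rintro ⟨p, q⟩ hpq
    by_cases hp : p = x
    · have hq : q ≠ y := fun hq => hpq (by rw [hp, hq])
      simp [single_apply, hq]
    · simp [single_apply, hp]

lemma hasSum_single (a : WeightedAlgebra w) : HasSum (fun x => a x • single w x) a := by
  have hs : Summable fun x => a x • single w x :=
    Summable.of_norm (a.summable.congr fun x => by rw [norm_smul, norm_single])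
  convert hs.hasSum
  ext y
  let ev : WeightedAlgebra w →L[ℂ] ℂ := LinearMap.mkContinuous
    { toFun := fun b => b y, map_add' := fun _ _ => rfl, map_smul' := fun _ _ => rfl } (w y)⁻¹
    fun b => by
      rw [inv_mul_eq_div, le_div_iff₀ (w.pos y)]
      exact norm_apply_mul_le b y
  change ev a = ev (∑' x, a x • single w x)
  rw [ev.map_tsum hs, tsum_eq_single y]
  · change a y = a y * single w y y
    simp [single_apply]
  · intro x hx
    change a x * single w x y = 0
    simp [single_apply, hx.symm]

lemma character_apply (χ : WeakDual.characterSpace ℂ (WeightedAlgebra w)) (a : WeightedAlgebra w) :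
    χ a = ∑' x, a x * χ (single w x) := by
  have h := (hasSum_single a).map χ (map_continuous χ)
  rw [← h.tsum_eq]
  exact tsum_congr fun x => by simp [Function.comp]

lemma norm_character_single_le (χ : WeakDual.characterSpace ℂ (WeightedAlgebra w)) (x : M) :
    ‖χ (single w x)‖ ≤ w x :=
  (AlgHom.norm_apply_le_self χ _).trans_eq (norm_single x)

/-- The root condition on an admissible weight forces its semicharacters into the unit disc. -/
lemma norm_character_single_le_one (hw : w.Admissible)
    (χ : WeakDual.characterSpace ℂ (WeightedAlgebra w)) (x : M) : ‖χ (single w x)‖ ≤ 1 := by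
  have hpow : ∀ k : ℕ, single w (k • x) = single w x ^ k := by
    intro k
    induction k with
    | zero => rw [zero_smul, pow_zero, single_zero]
    | succ k ih => rw [succ_nsmul, single_add, ih, pow_succ]
  refine ge_of_tendsto (hw.tendsto_root x) ?_
  filter_upwards [eventually_gt_atTop 0] with k hk
  have h := norm_character_single_le χ (k • x)
  rw [hpow, map_pow, norm_pow] at h
  calc ‖χ (single w x)‖ = (‖χ (single w x)‖ ^ k) ^ (1 / (k : ℝ)) := by
        rw [one_div, Real.pow_rpow_inv_natCast (norm_nonneg _) hk.ne']
    _ ≤ _ := Real.rpow_le_rpow (by positivity) h (by positivity)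

end WeightedAlgebra

/-! ### The unweighted algebras `ℓ¹(Λ)` and `ℓ¹(ℝ)` -/

/-- The constant weight `1`; its algebra is `ℓ¹(M)`. -/
def Weight.constOne (M : Type*) [AddCommMonoid M] : Weight M where
  toFun _ := 1
  pos' _ := one_pos
  map_zero' := rfl
  map_add_le' _ _ := by norm_num

namespace WeightedAlgebra

lemma constOne_apply {M : Type*} [AddCommMonoid M] (x : M) : Weight.constOne M x = 1 := rfl

open Classical in
/-- Extension by zero from `ℓ¹(Λ)` to `ℓ¹(ℝ)`, where `ℝ` is a discrete group. -/
def extendZero {Λ : AddSubmonoid ℝ} (a : WeightedAlgebra (Weight.constOne Λ)) :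
    WeightedAlgebra (Weight.constOne ℝ) :=
  mk (Function.extend Subtype.val a 0) (by
    refine (Subtype.val_injective.summable_iff (fun x hx => ?_)).1 (a.summable.congr fun l => ?_)
    · rw [Function.extend_apply' _ _ _ (by simpa using hx)]
      simp
    · simp only [Function.comp, Subtype.val_injective.extend_apply, constOne_apply])

variable {Λ : AddSubmonoid ℝ}

lemma extendZero_apply (a : WeightedAlgebra (Weight.constOne Λ)) (l : Λ) :
    extendZero a (l : ℝ) = a l :=
  Subtype.val_injective.extend_apply _ _ _

lemma extendZero_apply_of_notMem (a : WeightedAlgebra (Weight.constOne Λ)) {x : ℝ} (hx : x ∉ Λ) :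
    extendZero a x = 0 :=
  Function.extend_apply' _ _ _ (by simpa using hx)

lemma tsum_extendZero_mul (a : WeightedAlgebra (Weight.constOne Λ)) (φ : ℝ → ℂ) :
    ∑' x, extendZero a x * φ x = ∑' l : Λ, a l * φ l := by
  rw [← Subtype.val_injective.tsum_eq (f := fun x => extendZero a x * φ x)]
  · exact tsum_congr fun l => by rw [extendZero_apply]
  · intro x hx
    by_contra h
    exact hx (by simp only [extendZero_apply_of_notMem a (by simpa using h), zero_mul])

lemma norm_extendZero (a : WeightedAlgebra (Weight.constOne Λ)) : ‖extendZero a‖ = ‖a‖ := by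
  rw [norm_def, norm_def, ← Subtype.val_injective.tsum_eq]
  · exact tsum_congr fun l => by rw [extendZero_apply]; rfl
  · intro x hx
    by_contra h
    exact hx (by simp only [extendZero_apply_of_notMem a (by simpa using h), norm_zero, zero_mul])

lemma extendZero_mul (a b : WeightedAlgebra (Weight.constOne Λ)) :
    extendZero (a * b) = extendZero a * extendZero b := by
  classical
  ext x
  have hinj : Function.Injective (Prod.map Subtype.val Subtype.val : Λ × Λ → ℝ × ℝ) :=
    Subtype.val_injective.prodMap Subtype.val_injective
  have hsupp : Function.support (fun p : ℝ × ℝ => extendZero a p.1 * extendZero b p.2 *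
      (if p.1 + p.2 = x then 1 else 0)) ⊆
      Set.range (Prod.map Subtype.val Subtype.val : Λ × Λ → ℝ × ℝ) := by
    rintro ⟨y, z⟩ hp
    by_cases hy : y ∈ Λ
    · by_cases hz : z ∈ Λ
      · exact ⟨(⟨y, hy⟩, ⟨z, hz⟩), rfl⟩
      · exact absurd (by simp [extendZero_apply_of_notMem b hz]) hp
    · exact absurd (by simp [extendZero_apply_of_notMem a hy]) hp
  rw [mul_apply_prod, ← hinj.tsum_eq hsupp]
  by_cases hx : x ∈ Λ
  · lift x to Λ using hx
    rw [extendZero_apply, mul_apply_prod]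
    refine tsum_congr fun p => ?_
    simp only [Prod.map_fst, Prod.map_snd, extendZero_apply, ← AddSubmonoid.coe_add,
      Subtype.coe_inj]
    congr
  · rw [extendZero_apply_of_notMem _ hx, eq_comm]
    refine (tsum_congr fun p => ?_).trans tsum_zero
    rw [if_neg, mul_zero]
    exact fun h => hx (h ▸ (p.1 + p.2).2)

/-- Extension by zero as a ring homomorphism. -/
def extendZeroHom (Λ : AddSubmonoid ℝ) :
    WeightedAlgebra (Weight.constOne Λ) →+* WeightedAlgebra (Weight.constOne ℝ) where
  toFun := extendZero
  map_mul' := extendZero_mul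
  map_one' := by
    ext x
    by_cases hx : x ∈ Λ
    · lift x to Λ using hx
      rw [extendZero_apply]
      simp [one_apply]
    · have h0 : x ≠ 0 := fun h => hx (h ▸ Λ.zero_mem)
      simp [extendZero_apply_of_notMem _ hx, one_apply, h0]
  map_zero' := by
    ext x
    by_cases hx : x ∈ Λ
    · lift x to Λ using hx
      rw [extendZero_apply]; rfl
    · rw [extendZero_apply_of_notMem _ hx]; rfl
  map_add' a b := by
    ext x
    by_cases hx : x ∈ Λ
    · lift x to Λ using hx
      simp only [add_apply, extendZero_apply]
    · simp only [add_apply, extendZero_apply_of_notMem _ hx, add_zero]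

end WeightedAlgebra

/-! ### Invertibility along a path -/

/-- Along a path in a closed subring `A` of `B` that consists of units of `B`, the points that are
units of `A` form an open set, and a closed one because the inverses in `B` are locally bounded. -/
lemma isUnit_of_path {A B X : Type*} [NormedCommRing A] [CompleteSpace A] [Nontrivial A]
    [NormedCommRing B] [CompleteSpace B] [TopologicalSpace X] [PreconnectedSpace X]
    (j : A →+* B) (hj : ∀ a, ‖j a‖ = ‖a‖) {f : X → A} (hf : Continuous f)
    (hB : ∀ x, IsUnit (j (f x))) {x₀ : X} (h₀ : IsUnit (f x₀)) (x : X) : IsUnit (f x) := by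
  have hjc : Continuous j :=
    AddMonoidHomClass.continuous_of_bound j 1 fun a => by rw [hj, one_mul]
  have hopen : IsOpen {x | IsUnit (f x)} := Units.isOpen.preimage hf
  have hclosed : IsClosed {x | IsUnit (f x)} := by
    refine isClosed_of_closure_subset fun y hy => ?_
    have hinv : ContinuousAt (fun z => Ring.inverse (j (f z))) y := by
      obtain ⟨b, hb⟩ := hB y
      have := NormedRing.inverse_continuousAt b
      rw [hb] at this
      exact this.comp (f := fun z => j (f z)) (hjc.comp hf).continuousAt
    set K := ‖Ring.inverse (j (f y))‖ + 1
    have hK : 0 < K := by positivity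
    have h1 : ∀ᶠ z in 𝓝 y, ‖Ring.inverse (j (f z))‖ < K :=
      hinv.norm.eventually_lt continuousAt_const (by simp [K])
    have h2 : ∀ᶠ z in 𝓝 y, ‖f y - f z‖ < K⁻¹ := by
      have : ContinuousAt (fun z => ‖f y - f z‖) y := by fun_prop
      exact this.eventually_lt continuousAt_const (by simp [hK])
    obtain ⟨z, ⟨b, hb⟩, hz1, hz2⟩ :=
      ((mem_closure_iff_frequently.1 hy).and_eventually (h1.and h2)).exists
    have hbinv : ‖((b⁻¹ : Aˣ) : A)‖ < K := by
      rw [← hb, show j (b : A) = (Units.map (j : A →* B) b : Bˣ) from rfl, Ring.inverse_unit,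
        ← map_inv] at hz1
      rw [← hj]
      exact hz1
    have hpos : 0 < ‖((b⁻¹ : Aˣ) : A)‖ := norm_pos_iff.2 b⁻¹.ne_zero
    refine ⟨b.ofNearby (f y) ?_, rfl⟩
    rw [hb]
    exact hz2.trans ((inv_lt_inv₀ hK hpos).2 hbinv)
  exact Set.eq_univ_iff_forall.1 (IsClopen.eq_univ ⟨hclosed, hopen⟩ ⟨x₀, h₀⟩) x

/-! ### Kronecker's approximation theorem -/

lemma apply_zero_of_norm_eq_one {u : ℝ → ℂ} (hu : ∀ x, ‖u x‖ = 1)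
    (hadd : ∀ x y, u (x + y) = u x * u y) : u 0 = 1 := by
  have h := hadd 0 0
  have h0 : u 0 ≠ 0 := norm_ne_zero_iff.1 (by rw [hu]; exact one_ne_zero)
  rw [add_zero] at h
  exact (mul_eq_left₀ h0).1 h.symm

/-- The mean value of `t ↦ exp (-i x t)` over `[0, T]` tends to `1` if `x = 0`, to `0` otherwise. -/
lemma tendsto_mean_exp (x : ℝ) :
    Tendsto (fun T : ℝ => (T : ℂ)⁻¹ * ∫ t in (0 : ℝ)..T, Complex.exp (-(x * t) * Complex.I)) atTop
      (𝓝 (if x = 0 then 1 else 0)) := by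
  split_ifs with hx
  · refine tendsto_const_nhds.congr' ?_
    filter_upwards [eventually_gt_atTop 0] with T hT
    have : (T : ℂ) ≠ 0 := by exact_mod_cast hT.ne'
    simp [hx, this]
  · have hc : -(x : ℂ) * Complex.I ≠ 0 := by simp [hx]
    have hI : ∀ T : ℝ, ∫ t in (0 : ℝ)..T, Complex.exp (-(x * t) * Complex.I) =
        (Complex.exp (-(x : ℂ) * Complex.I * T) - 1) / (-(x : ℂ) * Complex.I) := by
      intro T
      have h := integral_exp_mul_complex hc (a := 0) (b := T)
      rw [Complex.ofReal_zero, mul_zero, Complex.exp_zero] at h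
      rw [← h]
      refine intervalIntegral.integral_congr fun t _ => ?_
      ring_nf
    have hb : ∀ T : ℝ, 0 < T → ‖(T : ℂ)⁻¹ * ∫ t in (0 : ℝ)..T,
        Complex.exp (-(x * t) * Complex.I)‖ ≤ T⁻¹ * (2 / |x|) := by
      intro T hT
      rw [hI, norm_mul, norm_inv, Complex.norm_real, Real.norm_of_nonneg hT.le, norm_div]
      have h1 : ‖Complex.exp (-(x : ℂ) * Complex.I * T)‖ = 1 := by
        rw [show -(x : ℂ) * Complex.I * T = ((-(x * T) : ℝ) : ℂ) * Complex.I by push_cast; ring,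
          Complex.norm_exp_ofReal_mul_I]
      have h2 : ‖-(x : ℂ) * Complex.I‖ = |x| := by simp
      rw [h2]
      gcongr
      calc _ ≤ ‖Complex.exp (-(x : ℂ) * Complex.I * T)‖ + ‖(1 : ℂ)‖ := norm_sub_le _ _
        _ = 2 := by rw [h1, norm_one]; norm_num
    refine squeeze_zero_norm' ?_ (by simpa using tendsto_inv_atTop_zero.mul_const (2 / |x|))
    filter_upwards [eventually_gt_atTop 0] with T hT using hb T hT

/-- Bessel's inequality for the supremum norm: the frequencies `μ i` may coincide, but then the
nonnegative coefficients `m i` add up, as the phases `v (μ i)` depend on the frequency only. -/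
lemma sum_sq_le_of_norm_sum_le {ι : Type*} (P : Finset ι) (m μ : ι → ℝ) (hm : ∀ i, 0 ≤ m i)
    {v : ℝ → ℂ} (hv : ∀ x, ‖v x‖ = 1) (hadd : ∀ x y, v (x + y) = v x * v y) {S : ℝ}
    (hS : ∀ t : ℝ, ‖∑ i ∈ P, m i * (v (μ i) * Complex.exp (-(μ i * t) * Complex.I))‖ ≤ S) :
    ∑ i ∈ P, m i ^ 2 ≤ S ^ 2 := by
  have hv0 := apply_zero_of_norm_eq_one hv hadd
  have hconj : ∀ x, (starRingEnd ℂ) (v x) = v (-x) := by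
    intro x
    have h1 : v x * v (-x) = 1 := by rw [← hadd, add_neg_cancel, hv0]
    rw [eq_comm, ← Complex.inv_eq_conj (hv x)]
    exact eq_inv_of_mul_eq_one_right h1
  set g : ℝ → ℂ := fun t => ∑ i ∈ P, m i * (v (μ i) * Complex.exp (-(μ i * t) * Complex.I)) with hg
  have hgg : ∀ t, g t * (starRingEnd ℂ) (g t) = ∑ i ∈ P, ∑ j ∈ P,
      (m i * m j * v (μ i - μ j)) * Complex.exp (-(((μ i - μ j : ℝ) : ℂ) * t) * Complex.I) := by
    intro t
    rw [hg, map_sum, Finset.sum_mul_sum]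
    refine Finset.sum_congr rfl fun i _ => Finset.sum_congr rfl fun j _ => ?_
    rw [map_mul, map_mul, hconj, ← Complex.exp_conj, sub_eq_add_neg (μ i), hadd,
      show -(((μ i + -μ j : ℝ) : ℂ) * t) * Complex.I = -(μ i * t) * Complex.I +
        (starRingEnd ℂ) (-(μ j * t) * Complex.I) by simp; ring, Complex.exp_add]
    simp
    ring
  have hlim : Tendsto (fun T : ℝ => (T : ℂ)⁻¹ * ∫ t in (0 : ℝ)..T, g t * (starRingEnd ℂ) (g t))
      atTop (𝓝 (∑ i ∈ P, ∑ j ∈ P, (m i * m j * v (μ i - μ j)) * if μ i - μ j = 0 then 1 else 0)) := by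
    have : (fun T : ℝ => (T : ℂ)⁻¹ * ∫ t in (0 : ℝ)..T, g t * (starRingEnd ℂ) (g t)) =
        fun T : ℝ => ∑ i ∈ P, ∑ j ∈ P, (m i * m j * v (μ i - μ j)) * ((T : ℂ)⁻¹ *
          ∫ t in (0 : ℝ)..T, Complex.exp (-(((μ i - μ j : ℝ) : ℂ) * t) * Complex.I)) := by
      funext T
      simp_rw [hgg]
      rw [intervalIntegral.integral_finsetSum
        fun i _ => Continuous.intervalIntegrable (by fun_prop) _ _, Finset.mul_sum]
      refine Finset.sum_congr rfl fun i _ => ?_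
      rw [intervalIntegral.integral_finsetSum
        fun i _ => Continuous.intervalIntegrable (by fun_prop) _ _, Finset.mul_sum]
      refine Finset.sum_congr rfl fun j _ => ?_
      rw [intervalIntegral.integral_const_mul]
      ring
    rw [this]
    exact tendsto_finsetSum _ fun i _ => tendsto_finsetSum _ fun j _ =>
      (tendsto_mean_exp _).const_mul _
  have hval : (∑ i ∈ P, ∑ j ∈ P, ((m i * m j * v (μ i - μ j)) *
      if μ i - μ j = 0 then 1 else 0 : ℂ)) =
      ((∑ i ∈ P, ∑ j ∈ P, if μ i - μ j = 0 then m i * m j else 0 : ℝ) : ℂ) := by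
    push_cast
    refine Finset.sum_congr rfl fun i _ => Finset.sum_congr rfl fun j _ => ?_
    split_ifs with h
    · rw [h, hv0]; push_cast; ring
    · simp
  have hle : ‖(∑ i ∈ P, ∑ j ∈ P, ((m i * m j * v (μ i - μ j)) *
      if μ i - μ j = 0 then 1 else 0 : ℂ))‖ ≤ S ^ 2 := by
    refine le_of_tendsto hlim.norm ?_
    filter_upwards [eventually_gt_atTop 0] with T hT
    have h1 : ‖∫ t in (0 : ℝ)..T, g t * (starRingEnd ℂ) (g t)‖ ≤ S ^ 2 * |T - 0| := by
      refine intervalIntegral.norm_integral_le_of_norm_le_const fun t _ => ?_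
      rw [norm_mul, RCLike.norm_conj, ← sq]
      exact pow_le_pow_left₀ (norm_nonneg _) (hS t) 2
    rw [sub_zero, abs_of_pos hT] at h1
    rw [norm_mul, norm_inv, Complex.norm_real, Real.norm_of_nonneg hT.le, inv_mul_le_iff₀ hT]
    linarith
  rw [hval, Complex.norm_real] at hle
  refine le_trans ?_ ((le_abs_self _).trans hle)
  refine Finset.sum_le_sum fun i hi => ?_
  calc m i ^ 2 = if μ i - μ i = 0 then m i * m i else 0 := by rw [if_pos (sub_self _), sq]
    _ ≤ _ := Finset.single_le_sum
      (f := fun j => if μ i - μ j = 0 then m i * m j else 0) (fun j _ => by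
        split_ifs
        · exact mul_nonneg (hm i) (hm j)
        · exact le_rfl) hi

/-- A sum of `n` exponentials whose phases are the values of a character of `ℝ` has supremum at
least `n`: the `k`-th power has at most `(k + 1) ^ n` terms, with nonnegative coefficients of sum
`n ^ k`, so Bessel's inequality bounds its supremum from below by nearly `n ^ k`. -/
lemma card_le_of_norm_sum_le {ι : Type*} [Fintype ι] [Nonempty ι] (x : ι → ℝ)
    {v : ℝ → ℂ} (hv : ∀ x, ‖v x‖ = 1) (hadd : ∀ x y, v (x + y) = v x * v y) {S : ℝ} (hS0 : 0 < S)
    (hS : ∀ t : ℝ, ‖∑ i, v (x i) * Complex.exp (-(x i * t) * Complex.I)‖ ≤ S) :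
    (Fintype.card ι : ℝ) ≤ S := by
  classical
  obtain ⟨n, hn⟩ : ∃ n : ℝ, n = (Fintype.card ι : ℝ) := ⟨_, rfl⟩
  rw [← hn]
  have hn0 : 0 < n := by rw [hn]; exact_mod_cast Fintype.card_pos
  have hpow : ∀ k : ℕ, (n ^ k) ^ 2 ≤ ((k : ℝ) + 1) ^ Fintype.card ι * (S ^ k) ^ 2 := by
    intro k
    set P := (Finset.univ : Finset ι).piAntidiag k
    have hprod : ∀ (e : ℝ → ℂ), (∀ x y, e (x + y) = e x * e y) → e 0 = 1 → ∀ α : ι → ℕ,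
        ∏ i, e (x i) ^ α i = e (∑ i, α i * x i) := by
      intro e he he0 α
      let E : Multiplicative ℝ →* ℂ :=
        { toFun := fun y => e y.toAdd, map_one' := he0, map_mul' := fun y z => he _ _ }
      have h1 : ∀ y, E (Multiplicative.ofAdd y) = e y := fun y => rfl
      simp_rw [← h1]
      rw [ofAdd_sum, map_prod]
      refine Finset.prod_congr rfl fun i _ => ?_
      rw [← map_pow, ← ofAdd_nsmul, nsmul_eq_mul]
    have hv0 := apply_zero_of_norm_eq_one hv hadd
    have h1 := sum_sq_le_of_norm_sum_le P (fun α => (Nat.multinomial Finset.univ α : ℝ))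
      (fun α => ∑ i, α i * x i) (fun α => Nat.cast_nonneg _) hv hadd (S := S ^ k) (by
        intro t
        have h := Finset.sum_pow_eq_sum_piAntidiag (Finset.univ : Finset ι)
          (fun i => v (x i) * Complex.exp (-(x i * t) * Complex.I)) k
        have h2 : ∀ α : ι → ℕ, ∏ i, (v (x i) * Complex.exp (-(x i * t) * Complex.I)) ^ α i =
            v (∑ i, α i * x i) * Complex.exp (-((∑ i, α i * x i : ℝ) * t) * Complex.I) := by
          intro α
          refine hprod (fun y => v y * Complex.exp (-(y * t) * Complex.I)) ?_ ?_ α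
          · intro y z
            rw [hadd, show -(((y + z : ℝ) : ℂ) * t) * Complex.I =
              -(y * t) * Complex.I + -(z * t) * Complex.I by push_cast; ring, Complex.exp_add]
            ring
          · simp [hv0]
        simp_rw [h2] at h
        have h3 := pow_le_pow_left₀ (norm_nonneg _) (hS t) k
        rw [← norm_pow, h] at h3
        simpa using h3)
    have h2 : (∑ α ∈ P, (Nat.multinomial Finset.univ α : ℝ)) = n ^ k := by
      have h := Finset.sum_pow_eq_sum_piAntidiag (Finset.univ : Finset ι) (fun _ => (1 : ℝ)) k
      simp only [one_pow, Finset.prod_const_one, mul_one] at h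
      rw [← h, hn]
      simp
    have h3 : (P.card : ℝ) ≤ ((k : ℝ) + 1) ^ Fintype.card ι := by
      have : P ⊆ Fintype.piFinset fun _ : ι => Finset.range (k + 1) := by
        intro α hα
        rw [Finset.mem_piAntidiag] at hα
        rw [Fintype.mem_piFinset]
        intro i
        rw [Finset.mem_range, Nat.lt_succ_iff, ← hα.1]
        exact Finset.single_le_sum (fun _ _ => Nat.zero_le _) (Finset.mem_univ i)
      have := Finset.card_le_card this
      rw [Fintype.card_piFinset, Finset.prod_const, Finset.card_range, Finset.card_univ] at this
      exact_mod_cast this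
    rw [← h2]
    exact sq_sum_le_card_mul_sum_sq.trans (mul_le_mul h3 h1
      (Finset.sum_nonneg fun _ _ => sq_nonneg _) (by positivity))
  by_contra! hlt
  set q := (S / n) ^ 2 with hq
  have hq0 : 0 < q := by positivity
  have hq1 : q < 1 := by
    rw [hq, sq_lt_one_iff₀ (by positivity), div_lt_one hn0]
    exact hlt
  have hlim := (tendsto_pow_const_mul_const_pow_of_lt_one (Fintype.card ι) hq0.le hq1).comp
    (tendsto_add_atTop_nat 1)
  refine absurd (ge_of_tendsto' hlim (b := q) fun k => ?_) (not_le.2 hq0)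
  have h := hpow k
  have h1 : 1 ≤ ((k : ℝ) + 1) ^ Fintype.card ι * q ^ k := by
    rw [hq, ← pow_mul, mul_comm 2, pow_mul, div_pow, div_pow, ← mul_div_assoc,
      one_le_div (by positivity)]
    exact h
  simp only [Function.comp, Nat.cast_add, Nat.cast_one]
  calc q = 1 * q := (one_mul _).symm
    _ ≤ ((k : ℝ) + 1) ^ Fintype.card ι * q ^ k * q := by gcongr
    _ = _ := by ring

/-- **Kronecker's theorem**: the continuous characters of `ℝ` are pointwise dense in the group of
all homomorphisms from `ℝ` to the unit circle. -/
theorem mem_closure_range_exp {u : ℝ → ℂ} (hu : ∀ x, ‖u x‖ = 1)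
    (hadd : ∀ x y, u (x + y) = u x * u y) :
    u ∈ closure (Set.range fun (t x : ℝ) => Complex.exp (-(x * t) * Complex.I)) := by
  classical
  have hu0 := apply_zero_of_norm_eq_one hu hadd
  have key : ∀ (F : Finset ℝ) (ε : ℝ), 0 < ε →
      ∃ t : ℝ, ∀ x ∈ F, ‖Complex.exp (-(x * t) * Complex.I) - u x‖ < ε := by
    intro F ε hε
    by_contra! hF
    have hne : Nonempty F := by
      obtain ⟨x, hx, -⟩ := hF 0
      exact ⟨⟨x, hx⟩⟩
    set δ := Real.sqrt (4 - ε ^ 2)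
    have hδ : δ < 2 := by
      rw [Real.sqrt_lt' (by norm_num)]
      nlinarith
    have hδ0 : 0 ≤ δ := Real.sqrt_nonneg _
    have hcard : (1 : ℝ) ≤ Fintype.card F := by exact_mod_cast Fintype.card_pos
    -- Each frequency is paired with the frequency `0`, whose term is `1`: a term near `1` in
    -- modulus but not in argument makes `‖1 + z‖` visibly smaller than `2`.
    have h := card_le_of_norm_sum_le (ι := F ⊕ F) (Sum.elim (fun x => (x : ℝ)) fun _ => 0)
      (v := fun x => (starRingEnd ℂ) (u x)) (fun x => by rw [RCLike.norm_conj, hu])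
      (fun x y => by rw [hadd, map_mul]) (S := 2 * (Fintype.card F - 1) + δ + (2 - δ) / 2)
      (by linarith) (by
        intro t
        set z : ℝ → ℂ := fun x => (starRingEnd ℂ) (u x) * Complex.exp (-(x * t) * Complex.I)
        have hz : ∀ x, ‖z x‖ = 1 := by
          intro x
          rw [norm_mul, RCLike.norm_conj, hu, one_mul,
            show -((x : ℂ) * t) * Complex.I = ((-(x * t) : ℝ) : ℂ) * Complex.I by push_cast; ring,
            Complex.norm_exp_ofReal_mul_I]
        obtain ⟨x, hx, hxε⟩ := hF t
        have hsub : ‖z x - 1‖ = ‖Complex.exp (-(x * t) * Complex.I) - u x‖ := by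
          have h1 : z x - 1 =
              (starRingEnd ℂ) (u x) * (Complex.exp (-(x * t) * Complex.I) - u x) := by
            rw [mul_sub, ← Complex.normSq_eq_conj_mul_self, Complex.normSq_eq_norm_sq, hu]
            simp [z]
          rw [h1, norm_mul, RCLike.norm_conj, hu, one_mul]
        have hzx : ‖z x + 1‖ ≤ δ := by
          refine Real.le_sqrt_of_sq_le ?_
          have := parallelogram_law_with_norm ℝ (z x) 1
          rw [hsub, hz, norm_one] at this
          nlinarith
        rw [Fintype.sum_sum_type]
        simp only [Sum.elim_inl, Sum.elim_inr]
        rw [← Finset.sum_add_distrib]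
        have hterm : ∀ y : F, (starRingEnd ℂ) (u y) * Complex.exp (-((y : ℝ) * t) * Complex.I) +
            (starRingEnd ℂ) (u 0) * Complex.exp (-((0 : ℝ) * t) * Complex.I) = z y + 1 := by
          intro y
          simp [z, hu0]
        rw [Finset.sum_congr rfl fun y _ => hterm y]
        refine (norm_sum_le _ _).trans ?_
        rw [← Finset.add_sum_erase _ _ (Finset.mem_univ (⟨x, hx⟩ : F))]
        have h2 : ∑ y ∈ Finset.univ.erase (⟨x, hx⟩ : F), ‖z y + 1‖ ≤
            2 * (Fintype.card F - 1) := by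
          refine (Finset.sum_le_card_nsmul _ _ 2 fun y _ => ?_).trans ?_
          · refine (norm_add_le _ _).trans ?_
            rw [hz, norm_one]; norm_num
          · rw [Finset.card_erase_of_mem (Finset.mem_univ _), Finset.card_univ, nsmul_eq_mul,
              Nat.cast_sub Fintype.card_pos]
            push_cast
            linarith
        linarith [hzx])
    rw [Fintype.card_sum] at h
    push_cast at h
    linarith
  rw [mem_closure_iff_nhds]
  intro t ht
  rw [nhds_pi] at ht
  obtain ⟨⟨F, r⟩, ⟨hF, hr⟩, hsub⟩ :=
    (hasBasis_pi fun x : ℝ => Metric.nhds_basis_ball (x := u x)).mem_iff.1 ht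
  obtain ⟨ε, hε, hεr⟩ : ∃ ε > 0, ∀ x ∈ F, ε ≤ r x := by
    simp only at hF hr
    clear hsub
    induction F, hF using Set.Finite.induction_on with
    | empty => exact ⟨1, one_pos, by simp⟩
    | @insert a s _ _ ih =>
      obtain ⟨ε, hε, h⟩ := ih fun i hi => hr i (Set.mem_insert_of_mem _ hi)
      refine ⟨min ε (r a), lt_min hε (hr a (Set.mem_insert _ _)), ?_⟩
      rintro x (rfl | hx)
      · exact min_le_right _ _
      · exact (min_le_left _ _).trans (h x hx)
  obtain ⟨s, hs⟩ := key hF.toFinset ε hε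
  refine ⟨_, hsub fun x hx => ?_, ⟨s, rfl⟩⟩
  rw [Metric.mem_ball, dist_eq_norm]
  exact (hs x (hF.mem_toFinset.2 hx)).trans_le (hεr x hx)

/-! ### Invertibility in `ℓ¹(Λ)` -/

namespace WeightedAlgebra

variable {Λ : AddSubmonoid ℝ}

lemma abs_rpow_le_one (hΛ : (Λ : Set ℝ) ⊆ Set.Ici 0) (r : unitInterval) (l : Λ) :
    |(r : ℝ) ^ (l : ℝ)| ≤ 1 := by
  rw [abs_of_nonneg (Real.rpow_nonneg r.2.1 _)]
  exact Real.rpow_le_one r.2.1 r.2.2 (hΛ l.2)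

/-- The family `l ↦ a l * r ^ l` for `0 ≤ r ≤ 1`. For `r = exp (-σ)` its Dirichlet series is that
of `a` translated by `σ`; as `0 ^ 0 = 1`, the value at `r = 0` is `a 0` times the unit, which stands
for the limit `σ → ∞`. -/
def dampen (hΛ : (Λ : Set ℝ) ⊆ Set.Ici 0) (a : WeightedAlgebra (Weight.constOne Λ))
    (r : unitInterval) : WeightedAlgebra (Weight.constOne Λ) :=
  mk (fun l => a l * (((r : ℝ) ^ (l : ℝ) : ℝ) : ℂ)) (by
    refine a.summable.of_nonneg_of_le (fun l => mul_nonneg (norm_nonneg _) (Weight.pos _ l).le) fun l => ?_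
    rw [norm_mul, Complex.norm_real, Real.norm_eq_abs, constOne_apply, mul_one, mul_one]
    exact mul_le_of_le_one_right (norm_nonneg _) (abs_rpow_le_one hΛ r l))

lemma dampen_apply
    (hΛ : (Λ : Set ℝ) ⊆ Set.Ici 0) (a : WeightedAlgebra (Weight.constOne Λ)) (r : unitInterval) (l : Λ) :
    dampen hΛ a r l = a l * (((r : ℝ) ^ (l : ℝ) : ℝ) : ℂ) := rfl

lemma dampen_zero
    (hΛ : (Λ : Set ℝ) ⊆ Set.Ici 0) (a : WeightedAlgebra (Weight.constOne Λ)) :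
    dampen hΛ a 0 = a 0 • 1 := by
  ext l
  rw [dampen_apply, smul_apply, one_apply]
  by_cases hl : l = 0
  · simp [hl]
  · have : (l : ℝ) ≠ 0 := by simpa using hl
    simp [hl, Real.zero_rpow this]

lemma dampen_one
    (hΛ : (Λ : Set ℝ) ⊆ Set.Ici 0) (a : WeightedAlgebra (Weight.constOne Λ)) : dampen hΛ a 1 = a := by
  ext l
  simp [dampen_apply]

lemma continuous_rpow_coe
    (hΛ : (Λ : Set ℝ) ⊆ Set.Ici 0) (l : Λ) : Continuous fun r : unitInterval => (r : ℝ) ^ (l : ℝ) :=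
  (Real.continuous_rpow_const (hΛ l.2)).comp continuous_subtype_val

lemma continuous_dampen (hΛ : (Λ : Set ℝ) ⊆ Set.Ici 0) (a : WeightedAlgebra (Weight.constOne Λ)) :
    Continuous (dampen hΛ a) := by
  refine continuous_iff_continuousAt.2 fun r => ?_
  rw [ContinuousAt, tendsto_iff_norm_sub_tendsto_zero]
  have hnorm : ∀ q, ‖dampen hΛ a q - dampen hΛ a r‖ =
      ∑' l : Λ, ‖a l‖ * |(q : ℝ) ^ (l : ℝ) - (r : ℝ) ^ (l : ℝ)| := by
    intro q
    rw [norm_def]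
    refine tsum_congr fun l => ?_
    rw [sub_eq_add_neg, add_apply, neg_apply, dampen_apply, dampen_apply, constOne_apply, mul_one,
      ← sub_eq_add_neg, ← mul_sub, norm_mul, ← Complex.ofReal_sub, Complex.norm_real,
      Real.norm_eq_abs]
  simp_rw [hnorm]
  -- The factor `1` is the weight, so that the bound is literally twice the norm of `a`.
  have h := tendsto_tsum_of_dominated_convergence (𝓕 := 𝓝 r)
    (f := fun (q : unitInterval) (l : Λ) => ‖a l‖ * |(q : ℝ) ^ (l : ℝ) - (r : ℝ) ^ (l : ℝ)|)
    (g := fun _ => 0) (bound := fun l => ‖a l‖ * 1 * 2) (a.summable.mul_right 2)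
    (fun l => by
      have := (((continuous_rpow_coe hΛ l).sub (continuous_const (y := (r : ℝ) ^ (l : ℝ)))).abs.const_mul
        ‖a l‖).tendsto r
      simpa using this)
    (Eventually.of_forall fun q l => by
      rw [norm_mul, norm_norm, Real.norm_eq_abs, abs_abs, mul_one]
      refine mul_le_mul_of_nonneg_left ((abs_sub _ _).trans ?_) (norm_nonneg _)
      linarith [abs_rpow_le_one hΛ q l, abs_rpow_le_one hΛ r l])
  simpa using h

/-- A lower bound for the Dirichlet series on the half-plane carries over to all twists by
characters of `ℝ`, by Kronecker's theorem and, at the ends `r = 0` and `r = 1`, by continuity. -/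
lemma le_norm_tsum_dampen
    (hΛ : (Λ : Set ℝ) ⊆ Set.Ici 0) (a : WeightedAlgebra (Weight.constOne Λ)) {δ : ℝ}
    (h : ∀ s : ℂ, 0 < s.re → δ ≤ ‖dirichletSeries a s‖) {u : ℝ → ℂ} (hu : ∀ x, ‖u x‖ = 1)
    (hadd : ∀ x y, u (x + y) = u x * u y) (r : unitInterval) :
    δ ≤ ‖∑' l : Λ, dampen hΛ a r l * u l‖ := by
  have hsum : Summable fun l => ‖a l‖ := a.summable.congr fun l => mul_one _
  have hbound : ∀ (r : unitInterval) (l : Λ) (z : ℂ), ‖z‖ = 1 → ‖dampen hΛ a r l * z‖ ≤ ‖a l‖ := by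
    intro r l z hz
    rw [norm_mul, hz, mul_one, dampen_apply, norm_mul, Complex.norm_real]
    exact mul_le_of_le_one_right (norm_nonneg _) (abs_rpow_le_one hΛ r l)
  have hcont : Continuous fun r : unitInterval => ∑' l : Λ, dampen hΛ a r l * u l := by
    refine continuous_tsum (fun l => ?_) hsum fun l r => hbound r l _ (hu l)
    exact ((Complex.continuous_ofReal.comp (continuous_rpow_coe hΛ l)).const_mul _).mul_const _
  have hIoo : ∀ r ∈ Set.Ioo (0 : unitInterval) 1, δ ≤ ‖∑' l : Λ, dampen hΛ a r l * u l‖ := by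
    intro r hr
    have hr0 : (0 : ℝ) < r := hr.1
    have hr1 : (r : ℝ) < 1 := hr.2
    set e : ℝ → ℝ → ℂ := fun t x => Complex.exp (-(x * t) * Complex.I)
    have hne : (comap e (𝓝 u)).NeBot := by
      have := mem_closure_range_exp hu hadd
      rw [mem_closure_iff_nhds] at this
      refine comap_neBot fun t ht => ?_
      obtain ⟨_, hy, x, rfl⟩ := this t ht
      exact ⟨x, hy⟩
    have hlim := tendsto_tsum_of_dominated_convergence (𝓕 := comap e (𝓝 u))
      (f := fun t (l : Λ) => dampen hΛ a r l * e t l)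
      (g := fun l => dampen hΛ a r l * u l) hsum
      (fun l => (tendsto_pi_nhds.1 (tendsto_comap (f := e)) (l : ℝ)).const_mul _)
      (Eventually.of_forall fun t l => hbound r l _ (by
        rw [show e t l = Complex.exp (((-(l * t) : ℝ) : ℂ) * Complex.I) by simp [e]]
        exact Complex.norm_exp_ofReal_mul_I _))
    refine ge_of_tendsto' hlim.norm fun t => ?_
    have hs := h (-Real.log r + t * Complex.I) (by
      simpa using Real.log_neg hr0 hr1)
    refine hs.trans_eq (congrArg _ (tsum_congr fun l => ?_))
    rw [dampen_apply, mul_assoc, Real.rpow_def_of_pos hr0, Complex.ofReal_exp, ← Complex.exp_add]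
    congr 2
    push_cast
    ring
  have hclosed : IsClosed {r : unitInterval | δ ≤ ‖∑' l : Λ, dampen hΛ a r l * u l‖} :=
    isClosed_le continuous_const hcont.norm
  have := closure_minimal hIoo hclosed
  rw [closure_Ioo zero_ne_one] at this
  exact this ⟨unitInterval.nonneg', unitInterval.le_one'⟩

lemma isUnit_extendZero_dampen
    (hΛ : (Λ : Set ℝ) ⊆ Set.Ici 0) (a : WeightedAlgebra (Weight.constOne Λ)) {δ : ℝ} (hδ : 0 < δ)
    (h : ∀ s : ℂ, 0 < s.re → δ ≤ ‖dirichletSeries a s‖) (r : unitInterval) :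
    IsUnit (extendZero (dampen hΛ a r)) := by
  by_contra hnot
  obtain ⟨χ, hχ⟩ := WeakDual.CharacterSpace.exists_apply_eq_zero hnot
  set u : ℝ → ℂ := fun x => χ (single _ x)
  have hadd : ∀ x y, u (x + y) = u x * u y := fun x y => by simp only [u, single_add, map_mul]
  have hle : ∀ x, ‖u x‖ ≤ 1 := fun x => norm_character_single_le χ x
  -- `u x` and `u (-x)` are mutually inverse and both in the unit disc.
  have hu : ∀ x, ‖u x‖ = 1 := by
    intro x
    refine le_antisymm (hle x) ?_
    have h1 : u x * u (-x) = 1 := by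
      rw [← hadd, add_neg_cancel]
      simp only [u, single_zero, map_one]
    calc 1 = ‖u x‖ * ‖u (-x)‖ := by rw [← norm_mul, h1, norm_one]
      _ ≤ ‖u x‖ := mul_le_of_le_one_right (norm_nonneg _) (hle _)
  have h2 := le_norm_tsum_dampen hΛ a h hu hadd r
  rw [← tsum_extendZero_mul, ← character_apply, hχ, norm_zero] at h2
  exact not_lt.2 h2 hδ

theorem isUnit_of_le_norm_dirichletSeries
    (hΛ : (Λ : Set ℝ) ⊆ Set.Ici 0) (a : WeightedAlgebra (Weight.constOne Λ)) {δ : ℝ}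
    (hδ : 0 < δ) (h : ∀ s : ℂ, 0 < s.re → δ ≤ ‖dirichletSeries a s‖) : IsUnit a := by
  have h0 : a 0 ≠ 0 := by
    have h1 := le_norm_tsum_dampen hΛ a h (u := fun _ => 1) (by simp) (by simp) 0
    rw [dampen_zero, tsum_eq_single 0 fun l hl => by simp [one_apply, hl]] at h1
    intro h2
    rw [h2] at h1
    simp at h1
    linarith
  have hunit : IsUnit (dampen hΛ a 0) := by
    rw [dampen_zero]
    exact (isUnit_one).smul (Units.mk0 _ h0)
  have : Nontrivial (WeightedAlgebra (Weight.constOne Λ)) := NormOneClass.nontrivial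
  have := isUnit_of_path (extendZeroHom Λ) norm_extendZero (continuous_dampen hΛ a)
    (isUnit_extendZero_dampen hΛ a hδ h) hunit 1
  rwa [dampen_one] at this

end WeightedAlgebra

/-! ### Invertibility in `𝒜_w(Λ)` -/

open WeightedAlgebra

lemma norm_exp_neg_mul_le {Λ : AddSubmonoid ℝ} (hΛ : (Λ : Set ℝ) ⊆ Set.Ici 0) {w : Weight Λ}
    (hw : w.Admissible) {s : ℂ} (hs : 0 ≤ s.re) (l : Λ) :
    ‖Complex.exp (-((l : ℝ) : ℂ) * s)‖ ≤ w l := by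
  refine le_trans ?_ (hw.one_le l)
  rw [Complex.norm_exp, Real.exp_le_one_iff]
  have : (0 : ℝ) ≤ (l : ℝ) := hΛ l.2
  simpa using mul_nonneg this hs

/-- If `b` is the inverse of `a`, then `‖b‖⁻¹` is a lower bound for the Dirichlet series of `a`. -/
lemma zero_notMem_closure_of_isUnit {Λ : AddSubmonoid ℝ} (hΛ : (Λ : Set ℝ) ⊆ Set.Ici 0)
    {w : Weight Λ} (hw : w.Admissible) {a : WeightedAlgebra w} (ha : IsUnit a) :
    (0 : ℂ) ∉ closure (dirichletSeries a '' {s : ℂ | 0 < s.re}) := by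
  obtain ⟨b, hab⟩ := ha.exists_right_inv
  have hb : 0 < ‖b‖ := norm_pos_iff.2 fun hb => by
    rw [hb, mul_zero] at hab
    have := congrArg norm hab
    simp at this
  rw [Metric.mem_closure_iff]
  intro h
  obtain ⟨_, ⟨s, hs, rfl⟩, hlt⟩ := h ‖b‖⁻¹ (inv_pos.2 hb)
  have hs' : 0 ≤ s.re := le_of_lt hs
  have hmul := tsum_mul_char_mul a b (norm_exp_neg_mul_le hΛ hw hs') fun x y => by
    rw [← Complex.exp_add, AddSubmonoid.coe_add]
    push_cast
    ring_nf
  rw [hab, tsum_one_mul_char (by simp)] at hmul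
  have h1 := congrArg norm hmul
  rw [norm_one, norm_mul] at h1
  have h2 := norm_tsum_mul_char_le b (norm_exp_neg_mul_le hΛ hw hs')
  rw [dist_zero_left] at hlt
  have h3 : ‖dirichletSeries a s‖ * ‖b‖ < 1 := by
    rwa [← lt_div_iff₀ hb, one_div]
  have h4 := mul_le_mul_of_nonneg_left h2 (norm_nonneg (dirichletSeries a s))
  exact absurd h1 (h4.trans_lt h3).ne'

theorem theorem1 (Λ : AddSubmonoid ℝ) (hΛ : (Λ : Set ℝ) ⊆ Set.Ici 0)
    (w : Weight Λ) (hw : w.Admissible) :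
    {a : WeightedAlgebra w | IsUnit a} =
      {a : WeightedAlgebra w |
        (0 : ℂ) ∉ closure (dirichletSeries a '' {s : ℂ | 0 < s.re})} := by
  ext a
  refine ⟨zero_notMem_closure_of_isUnit hΛ hw, fun h => ?_⟩
  simp only [Set.mem_ofPred_eq, Metric.mem_closure_iff] at h ⊢
  push Not at h
  obtain ⟨δ, hδ, hle⟩ := h
  let a₁ : WeightedAlgebra (Weight.constOne Λ) := mk a (a.summable.of_nonneg_of_le
    (fun l => mul_nonneg (norm_nonneg _) (Weight.pos _ l).le)
    fun l => mul_le_mul_of_nonneg_left (hw.one_le l) (norm_nonneg _))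
  have ha₁ : IsUnit a₁ := isUnit_of_le_norm_dirichletSeries hΛ a₁ hδ fun s hs => by
    have := hle _ ⟨s, hs, rfl⟩
    rwa [dist_zero_left] at this
  obtain ⟨b, hb⟩ := ha₁.exists_right_inv
  by_contra hnot
  obtain ⟨χ, hχ⟩ := WeakDual.CharacterSpace.exists_apply_eq_zero hnot
  -- The semicharacter of `χ` is bounded by `1`, so it acts on `ℓ¹(Λ)` too, where `a` is invertible.
  have hmul := tsum_mul_char_mul a₁ b (φ := fun l => χ (single w l))
    (norm_character_single_le_one hw χ) fun x y => by rw [single_add, map_mul]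
  have h0 : ∑' l, a₁ l * χ (single w l) = 0 := (character_apply χ a).symm.trans hχ
  rw [hb, tsum_one_mul_char (by rw [single_zero, map_one]), h0, zero_mul] at hmul
  exact one_ne_zero hmul

end
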